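/- Let $k$ be an even positive integer, $s$ a positive integer, $\mathbb{F}=\mathbb{F}_{2^k}$ with a fixed algebraically closed extension $\Omega$, and $A$ a finite abelian group (written additively) of odd order. **Codes.** For a finite commutative ring $R$ and a finite abelian group $G$, an abelian code in the group ring $R[G]$ is an ideal $C$ of $R[G]$ (a cyclic code of length $n$ over $R$ if $G=\mathbb{Z}_n$). Its Euclidean dual is $C^{\perp_{\rm E}}=\{\sum_g\alpha_gY^g \mid \sum_g\alpha_g\beta_g=0 \text{ for all } \sum_g\beta_gY^g\in C\}$. If $R=\mathbb{F}_{q^2}$ or $R=\mathbb{F}_{q^2}+u\mathbb{F}_{q^2}$ with $u^2=0$, put $\rho(a)=a^q$, respectively $\rho(a+ub)=a^q+ub^q$; the Hermitian dual $C^{\perp_{\rm H}}$ is defined in the same way with $\sum_g\alpha_g\rho(\beta_g)$ in place of $\sum_g\alpha_g\beta_g$, and $C$ is Hermitian self-dual if $C=C^{\perp_{\rm H}}$. **Classes.** For $a\in A$ let $S(a)=\{2^{ki}a\mid i\ge 0\}$ be its $2^k$-cyclotomic class and $k_a=k|S(a)|$. The class $S(a)$ is of type ${\rm I}'$ if $S(a)=S(-2^{k/2}a)$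 and of type ${\rm II}'$ otherwise. Let $a_1,\dots,a_{r_1}$ (of type ${\rm I}'$), together with $b_1,\dots,b_{r_2}$ (of type ${\rm II}'$) and $-2^{k/2}b_1,\dots,-2^{k/2}b_{r_2}$, be a complete set of representatives, without repetition, of the $2^k$-cyclotomic classes of $A$. **Decomposition.** Fix an isomorphism $a\mapsto\psi_a$ from $A$ to the group of characters $A\to\Omega^\times$. For $a\in A$ let $K_a=\mathbb{F}(\psi_a(x): x\in A)\subseteq\Omega$. Let $\Phi_a:\mathbb{F}[A\times\mathbb{Z}_2\times\mathbb{Z}_{2^s}]\to(K_a+uK_a)[\mathbb{Z}_{2^s}]$ be the ring homomorphism $$cY^{(x,y,z)}\mapsto c\,\psi_a(x)\,(1+u)^{y}\,Y^{z},$$ that is, the discrete Fourier transform at $a$ followed by $K_a[\mathbb{Z}_2]\cong K_a+uK_a$, $Y^1\mapsto 1+u$. The fields $K_{-2^{k/2}a}$ and $K_a$ coincide. Let $\Phi'_a$ be $\Phi_{-2^{k/2}a}$ followed by the map induced on coefficients by the inverse of the automorphism $t\mapsto t^{2^{k/2}}$ of $K_a$; explicitly, $\Phi'_a(cY^{(x,y,z)})=c^{2^{k/2}}\psi_a(-x)(1+u)^yY^z$.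 Write $\mathcal{S}_j=K_{a_j}+uK_{a_j}$ and $\mathcal{T}_l=K_{b_l}+uK_{b_l}$. Then $|K_a|=2^{k_a}$ for all $a\in A$, and the maps $\Phi_{a_j}$, $\Phi_{b_l}$, $\Phi'_{b_l}$ together give a ring isomorphism $$\mathbb{F}_{2^k}[A\times\mathbb{Z}_2\times\mathbb{Z}_{2^s}]\cong\prod_{j=1}^{r_1}\mathcal{S}_j[\mathbb{Z}_{2^s}]\times\prod_{l=1}^{r_2}\bigl(\mathcal{T}_l[\mathbb{Z}_{2^s}]\times\mathcal{T}_l[\mathbb{Z}_{2^s}]\bigr).$$ Under it, every abelian code $C$ in $\mathbb{F}_{2^k}[A\times\mathbb{Z}_2\times\mathbb{Z}_{2^s}]$ corresponds to the product $$\prod_{j=1}^{r_1}C_j\times\prod_{l=1}^{r_2}(D_l\times D'_l)$$ of the cyclic codes $C_j=\Phi_{a_j}(C)$, $D_l=\Phi_{b_l}(C)$, $D'_l=\Phi'_{b_l}(C)$ of length $2^s$ over $\mathcal{S}_j$, $\mathcal{T}_l$, $\mathcal{T}_l$. Moreover, $C$ is Hermitian self-dual if and only if 1. $C_j$ is a Hermitian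 self-dual cyclic code of length $2^s$ over $\mathcal{S}_j$ for all $j=1,\dots,r_1$, and 2. $D'_l=D_l^{\perp_{\rm E}}$ is a cyclic code of length $2^s$ over $\mathcal{T}_l$ for all $l=1,\dots,r_2$. -/

import Mathlib

namespace AbelianCode

/-! ### Inner products and duals in group rings -/

section Dual

variable {R G : Type*} [CommRing R] [AddCommGroup G] [Fintype G]

/-- The Euclidean inner product `∑ α_g β_g` of `u = ∑ α_g Y^g` and `v = ∑ β_g Y^g` in `R[G]`. -/
def euclideanInner (u v : AddMonoidAlgebra R G) : R :=
  ∑ g : G, u.coeff g * v.coeff g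

/-- The inner product `∑ α_g ρ(β_g)` of `u = ∑ α_g Y^g` and `v = ∑ β_g Y^g` in `R[G]`, for a
ring endomorphism `ρ` of `R`. -/
def twistedInner (ρ : R →+* R) (u v : AddMonoidAlgebra R G) : R :=
  ∑ g : G, u.coeff g * ρ (v.coeff g)

/-- The Euclidean dual of a code in `R[G]`. -/
def euclideanDual (C : Ideal (AddMonoidAlgebra R G)) : Set (AddMonoidAlgebra R G) :=
  {u | ∀ v ∈ C, euclideanInner u v = 0}

/-- The dual of a code in `R[G]` with respect to the `ρ`-inner product. -/
def twistedDual (ρ : R →+* R) (C : Ideal (AddMonoidAlgebra R G)) :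
    Set (AddMonoidAlgebra R G) :=
  {u | ∀ v ∈ C, twistedInner ρ u v = 0}

end Dual

/-! ### The ring `L + uL`, `u² = 0`, i.e. the dual numbers over `L` -/

section DualNumbers

variable {L M : Type*} [Field L] [Field M]

/-- The ring homomorphism `a + ub ↦ f(a) + u f(b)` from `L + uL` to `M + uM`. -/
def dualMap (f : L →+* M) : DualNumber L →+* DualNumber M where
  toFun z := TrivSqZeroExt.inl (f z.fst) + TrivSqZeroExt.inr (f z.snd)
  map_one' := by ext <;> simp
  map_mul' x y := by ext <;> simp [mul_comm]
  map_zero' := by ext <;> simp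
  map_add' x y := by ext <;> simp

instance charP_intermediateField {F Ω : Type*} [Field F] [Field Ω] [Algebra F Ω] [CharP F 2]
    (K : IntermediateField F Ω) : CharP K 2 :=
  charP_of_injective_algebraMap (algebraMap F K).injective 2

lemma one_add_eps_pow [CharP L 2] (x y : ZMod 2) :
    (1 + DualNumber.eps : DualNumber L) ^ (x + y).val =
      (1 + DualNumber.eps) ^ x.val * (1 + DualNumber.eps) ^ y.val := by
  have h2 : (1 + 1 : L) = 0 := CharTwo.add_self_eq_zero 1
  have h : (1 + DualNumber.eps : DualNumber L) ^ 2 = 1 := by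
    ext
    · simp [pow_two]
    · simpa [pow_two] using h2
  rw [← pow_add, ZMod.val_add]
  conv_rhs => rw [← Nat.mod_add_div (x.val + y.val) 2, pow_add, pow_mul, h, one_pow, mul_one]

end DualNumbers

/-! ### Cyclotomic classes -/

section Cyclotomic

variable {A : Type*} [AddCommGroup A]

/-- The `2^k`-cyclotomic class `{2^{ki} · a | i = 0, 1, …}` of `A` containing `a`. -/
def cycClass (k : ℕ) (a : A) : Set A := {x | ∃ i : ℕ, x = 2 ^ (k * i) • a}

/-- The class of `a` is of type I′ if it is also the class of `-2^{k/2} a`; otherwise it is of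
type II′. -/
def IsTypeI' (k : ℕ) (a : A) : Prop := cycClass k a = cycClass k (-(2 ^ (k / 2) • a))

/-- The integer `k_a = k |S(a)|`; the component of the group algebra that belongs to the class of
`a` is the field with `2^{k_a}` elements. -/
noncomputable def classExp (k : ℕ) (a : A) : ℕ := k * (cycClass k a).ncard

/-- `a_j` (`j < r₁`), `b_l` and `-2^{k/2} b_l` (`l < r₂`) form a complete set of representatives of
the `2^k`-cyclotomic classes of `A`, the `a_j` being of type I′ and the `b_l` of type II′. -/
structure IsRepresentatives (k : ℕ) {r₁ r₂ : ℕ} (a : Fin r₁ → A) (b : Fin r₂ → A) : Prop where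
  typeI : ∀ j, IsTypeI' k (a j)
  typeII : ∀ l, ¬ IsTypeI' k (b l)
  complete : ∀ x : A, ∃! i : Fin r₁ ⊕ (Fin r₂ ⊕ Fin r₂),
    cycClass k (Sum.elim a (Sum.elim b fun l => -(2 ^ (k / 2) • b l)) i) = cycClass k x

end Cyclotomic

/-! ### The components of the group algebra -/

section Components

variable {F Ω A : Type*} [Field F] [Field Ω] [Algebra F Ω] [AddCommGroup A]

/-- The monoid homomorphism `Y^{(x, y, z)} ↦ χ(x) (1 + u)^y Y^z`. -/
noncomputable def dftMonomial {L : Type*} [Field L] [CharP L 2] (s : ℕ) (χ : AddChar A L) :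
    Multiplicative (A × ZMod 2 × ZMod (2 ^ s)) →*
      AddMonoidAlgebra (DualNumber L) (ZMod (2 ^ s)) where
  toFun g := AddMonoidAlgebra.single g.toAdd.2.2
    (TrivSqZeroExt.inl (χ g.toAdd.1) * (1 + DualNumber.eps) ^ g.toAdd.2.1.val)
  map_one' := by simp [AddMonoidAlgebra.one_def]
  map_mul' g h := by
    rw [AddMonoidAlgebra.single_mul_single]
    simp only [toAdd_mul, Prod.fst_add, Prod.snd_add, AddChar.map_add_eq_mul,
      TrivSqZeroExt.inl_mul, one_add_eps_pow]
    congr 1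
    ring

/-- For a character `χ` of `A` with values in an extension `σ : F → L`, the ring homomorphism
`F[A × ℤ₂ × ℤ_{2^s}] → (L + uL)[ℤ_{2^s}]` that sends `c Y^{(x, y, z)}` to
`σ(c) χ(x) (1 + u)^y Y^z`: the discrete Fourier transform at `χ` on `F[A]`, followed by
`L[ℤ₂] ≅ L + uL`, `Y^1 ↦ 1 + u`. -/
noncomputable def dft {L : Type*} [Field L] [CharP L 2] (s : ℕ) (σ : F →+* L) (χ : AddChar A L) :
    AddMonoidAlgebra F (A × ZMod 2 × ZMod (2 ^ s)) →+*
      AddMonoidAlgebra (DualNumber L) (ZMod (2 ^ s)) :=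
  AddMonoidAlgebra.liftNCRingHom
    ((AddMonoidAlgebra.singleZeroRingHom.comp (TrivSqZeroExt.inlHom L L)).comp σ)
    (dftMonomial s χ)
    (fun c g => Commute.all
      (((AddMonoidAlgebra.singleZeroRingHom.comp (TrivSqZeroExt.inlHom L L)).comp σ) c)
      (dftMonomial s χ g))

lemma dft_single {L : Type*} [Field L] [CharP L 2] (s : ℕ) (σ : F →+* L) (χ : AddChar A L)
    (c : F) (x : A) (y : ZMod 2) (z : ZMod (2 ^ s)) :
    dft s σ χ (AddMonoidAlgebra.single (x, y, z) c) =
      AddMonoidAlgebra.single z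
        (TrivSqZeroExt.inl (σ c * χ x) * (1 + DualNumber.eps) ^ y.val) := by
  simp [dft, dftMonomial, AddMonoidAlgebra.single_mul_single, TrivSqZeroExt.inl_mul, mul_assoc]

/-- An isomorphism `ψ` from `A` to its character group identifies the elements of `A` with the
points at which the discrete Fourier transform is evaluated. The component of `F[A]` at `a` is the
field generated over `F` by the values of the character `ψ a`. -/
noncomputable abbrev compField (F : Type*) {Ω A : Type*} [Field F] [Field Ω] [Algebra F Ω]
    [AddCommGroup A] (ψ : A ≃+ AddChar A Ω) (a : A) : IntermediateField F Ω :=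
  IntermediateField.adjoin F (Set.range (ψ a))

/-- A character with values in `K`, viewed as a `K`-valued character. -/
def restrictChar (K : IntermediateField F Ω) (χ : AddChar A Ω) (h : ∀ x, χ x ∈ K) :
    AddChar A K where
  toFun x := ⟨χ x, h x⟩
  map_zero_eq_one' := Subtype.ext (by simp)
  map_add_eq_mul' x y := Subtype.ext (by simp [AddChar.map_add_eq_mul])

lemma mem_compField (ψ : A ≃+ AddChar A Ω) (a x : A) : ψ a x ∈ compField F ψ a :=
  IntermediateField.subset_adjoin _ _ ⟨x, rfl⟩

lemma neg_nsmul_mem_compField (ψ : A ≃+ AddChar A Ω) (a : A) (n : ℕ) (x : A) :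
    ψ (-(n • a)) x ∈ compField F ψ a := by
  have h : ψ (-(n • a)) x = (ψ a (-x)) ^ n := by
    rw [map_neg, map_nsmul, AddChar.neg_apply, AddChar.nsmul_apply]
  rw [h]
  exact pow_mem (mem_compField ψ a (-x)) n

/-- The ring `K_a + u K_a` with `K_a` the component of `F[A]` at `a`. -/
abbrev CompRing (F : Type*) {Ω A : Type*} [Field F] [Field Ω] [Algebra F Ω]
    [AddCommGroup A] (ψ : A ≃+ AddChar A Ω) (a : A) : Type _ :=
  DualNumber (compField F ψ a)

variable [CharP F 2]

/-- The component of `F[A × ℤ₂ × ℤ_{2^s}]` at `a`. -/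
noncomputable def comp (s : ℕ) (ψ : A ≃+ AddChar A Ω) (a : A) :
    AddMonoidAlgebra F (A × ZMod 2 × ZMod (2 ^ s)) →+*
      AddMonoidAlgebra (CompRing F ψ a) (ZMod (2 ^ s)) :=
  dft s (algebraMap F (compField F ψ a)) (restrictChar _ (ψ a) (mem_compField ψ a))

/-- The component of `F[A × ℤ₂ × ℤ_{2^s}]` at `-2^{k/2} a`, identified with a component with
coefficients in the same ring `K_a + u K_a`: the Fourier transform at `-2^{k/2} a` is followed, on
coefficients, by the inverse of the automorphism `z ↦ z^{2^{k/2}}` of `K_a`, that is by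
`z ↦ z^{2^{k_a - k/2}}`, as `K_a` has `2^{k_a}` elements. For `F` with `2^k` elements it sends
`c Y^{(x, y, z)}` to `c^{2^{k/2}} ψ_a(-x) (1 + u)^y Y^z`. -/
noncomputable def partnerComp (k s : ℕ) (ψ : A ≃+ AddChar A Ω) (a : A) :
    AddMonoidAlgebra F (A × ZMod 2 × ZMod (2 ^ s)) →+*
      AddMonoidAlgebra (CompRing F ψ a) (ZMod (2 ^ s)) :=
  (AddMonoidAlgebra.mapRingHom (ZMod (2 ^ s))
      (dualMap (iterateFrobenius (compField F ψ a) 2 (classExp k a - k / 2)))).comp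
    (dft s (algebraMap F (compField F ψ a))
      (restrictChar _ (ψ (-(2 ^ (k / 2) • a))) (neg_nsmul_mem_compField ψ a _)))

/-- The decomposition
`F[A × ℤ₂ × ℤ_{2^s}] → ∏_j S_j[ℤ_{2^s}] × ∏_l (T_l[ℤ_{2^s}] × T_l[ℤ_{2^s}])`. -/
noncomputable def decomposition (k s : ℕ) (ψ : A ≃+ AddChar A Ω) {r₁ r₂ : ℕ}
    (a : Fin r₁ → A) (b : Fin r₂ → A) :
    AddMonoidAlgebra F (A × ZMod 2 × ZMod (2 ^ s)) →+*
      (∀ j, AddMonoidAlgebra (CompRing F ψ (a j)) (ZMod (2 ^ s))) ×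
      (∀ l, AddMonoidAlgebra (CompRing F ψ (b l)) (ZMod (2 ^ s)) ×
        AddMonoidAlgebra (CompRing F ψ (b l)) (ZMod (2 ^ s))) :=
  (RingHom.pi fun j => comp s ψ (a j)).prod
    (RingHom.pi fun l => (comp s ψ (b l)).prod (partnerComp k s ψ (b l)))

/-! ### Hermitian self-dual codes -/

/-- Hermitian self-duality of an abelian code over a field with `2^k` elements, `k` even: the
conjugation is `c ↦ c^{2^{k/2}}`. -/
def IsHermitianSelfDual (k : ℕ) {G : Type*} [AddCommGroup G] [Fintype G]
    (C : Ideal (AddMonoidAlgebra F G)) : Prop :=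
  (C : Set (AddMonoidAlgebra F G)) = twistedDual (iterateFrobenius F 2 (k / 2)) C

/-- Hermitian self-duality of an abelian code over `F + uF`, where `F` has `2^k` elements, `k`
even: the conjugation is `a + ub ↦ a^{2^{k/2}} + u b^{2^{k/2}}`. -/
def IsHermitianSelfDualU (k : ℕ) {G : Type*} [AddCommGroup G] [Fintype G]
    (C : Ideal (AddMonoidAlgebra (DualNumber F) G)) : Prop :=
  (C : Set (AddMonoidAlgebra (DualNumber F) G)) =
    twistedDual (dualMap (iterateFrobenius F 2 (k / 2))) C

end Components

end AbelianCode

/-! Since a code `C` is an ideal, it is closed under multiplication by every `Y^g`, and the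
coefficients of `u * conjHom ρ v` are the inner products of `u` with these translates of `v`. So the
Hermitian dual is the annihilator of the conjugates of `C` (`mem_twistedDual_iff`), a purely
ring-theoretic object that a product decomposition computes componentwise
(`mem_map_iff_forall_mul_eq_zero`).

The decomposition is injective because distinct characters are linearly independent and the
Frobenius of `F` reaches a whole class from one representative; it is bijective by counting, as
`|K_a| = 2^{k_a}` and the sizes of the classes add up to `|A|`.

It remains to follow the conjugation. At a type I′ point it becomes the Hermitian conjugation of the
component (`comp_conjHom_of_isTypeI'`). At a type II′ point it swaps the two components, up to `Y ↦
Y⁻¹` (`comp_conjHom`, `partnerComp_conjHom`). Hence self-duality means that each `C_j` is Hermitian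
self-dual, that `D'_l` is the Euclidean dual of `D_l`, and that `D_l` is the Euclidean dual of
`D'_l`. The last two conditions are equivalent by the double dual property over `L + uL`
(`eq_euclideanDual_symm`). -/

namespace AbelianCode

/-! ### Inner products, conjugation, and duals as annihilators -/

section Inner

variable {R G : Type*} [CommRing R] [Fintype G]

lemma euclideanInner_comm (u v : AddMonoidAlgebra R G) :
    euclideanInner u v = euclideanInner v u := by
  simp [euclideanInner, mul_comm]

lemma euclideanInner_single [DecidableEq G] (u : AddMonoidAlgebra R G) (g : G) (r : R) :
    euclideanInner u (AddMonoidAlgebra.single g r) = u.coeff g * r := by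
  simp [euclideanInner, Finsupp.single_apply]

end Inner

section Conj

variable {R G : Type*} [CommRing R] [AddCommGroup G]

/-- The ring endomorphism `∑ α_g Y^g ↦ ∑ ρ(α_g) Y^{-g}` of `R[G]`. -/
noncomputable def conjHom (ρ : R →+* R) : AddMonoidAlgebra R G →+* AddMonoidAlgebra R G :=
  (AddMonoidAlgebra.mapDomainRingHom R (negAddMonoidHom : G →+ G)).comp
    (AddMonoidAlgebra.mapRingHom G ρ)

@[simp] lemma conjHom_single (ρ : R →+* R) (g : G) (r : R) :
    conjHom ρ (AddMonoidAlgebra.single g r) = AddMonoidAlgebra.single (-g) (ρ r) := by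
  simp [conjHom]

lemma coeff_conjHom (ρ : R →+* R) (v : AddMonoidAlgebra R G) (g : G) :
    (conjHom ρ v).coeff g = ρ (v.coeff (-g)) := by
  classical
  induction v using AddMonoidAlgebra.induction_linear with
  | zero => simp
  | add x y hx hy => simp [hx, hy]
  | single h r =>
    simp only [conjHom_single, AddMonoidAlgebra.coeff_single, Finsupp.single_apply,
      neg_eq_iff_eq_neg]
    split_ifs <;> simp

lemma conjHom_eq_conjHom_id (ρ : R →+* R) (v : AddMonoidAlgebra R G) :
    conjHom ρ v = conjHom (RingHom.id R) (AddMonoidAlgebra.mapRingHom G ρ v) := by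
  simp [conjHom]

variable [Fintype G]

lemma coeff_mul_conjHom (ρ : R →+* R) (u v : AddMonoidAlgebra R G) (g : G) :
    (u * conjHom ρ v).coeff g = twistedInner ρ u (AddMonoidAlgebra.single g 1 * v) := by
  rw [AddMonoidAlgebra.coeff_mul_apply_left, Finsupp.sum_fintype _ _ (by simp)]
  simp only [twistedInner, coeff_conjHom, AddMonoidAlgebra.coeff_single_mul_apply, one_mul,
    neg_add_rev, neg_neg]

/-- One vanishing inner product is only the coefficient at `0` of the product; the other
coefficients vanish because `C` contains all the translates `Y^g v`. -/
lemma mem_twistedDual_iff (ρ : R →+* R) (C : Ideal (AddMonoidAlgebra R G))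
    (u : AddMonoidAlgebra R G) :
    u ∈ twistedDual ρ C ↔ ∀ v ∈ C, u * conjHom ρ v = 0 := by
  refine ⟨fun h v hv => ?_, fun h v hv => ?_⟩
  · ext g
    rw [coeff_mul_conjHom]
    exact h _ (C.mul_mem_left _ hv)
  · have := coeff_mul_conjHom ρ u v 0
    rw [h v hv, ← AddMonoidAlgebra.one_def, one_mul] at this
    exact this.symm

lemma euclideanInner_single_zero_mul (u v : AddMonoidAlgebra R G) (r : R) :
    euclideanInner u (AddMonoidAlgebra.single 0 r * v) = r * euclideanInner u v := by
  simp [euclideanInner, Finset.mul_sum, mul_left_comm]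

/-- The dual of a code with respect to the `ρ`-inner product, as an ideal. -/
noncomputable def twistedDualIdeal (ρ : R →+* R) (C : Ideal (AddMonoidAlgebra R G)) :
    Ideal (AddMonoidAlgebra R G) where
  carrier := twistedDual ρ C
  add_mem' hx hy := by
    rw [mem_twistedDual_iff] at *
    intro v hv
    rw [add_mul, hx v hv, hy v hv, add_zero]
  zero_mem' := by simp [mem_twistedDual_iff]
  smul_mem' c x hx := by
    rw [mem_twistedDual_iff] at *
    intro v hv
    rw [smul_eq_mul, mul_assoc, hx v hv, mul_zero]

lemma mem_twistedDualIdeal_iff (ρ : R →+* R) (C : Ideal (AddMonoidAlgebra R G))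
    (u : AddMonoidAlgebra R G) :
    u ∈ twistedDualIdeal ρ C ↔ ∀ v ∈ C, u * conjHom ρ v = 0 :=
  mem_twistedDual_iff ρ C u

end Conj

/-! ### The double dual over `L + uL` -/

section DoubleDual

variable {L G : Type*} [Field L] [AddCommGroup G] [Fintype G]

instance finite_dualNumber : Module.Finite L (DualNumber L) :=
  inferInstanceAs (Module.Finite L (L × L))

instance finite_dualNumber_groupRing :
    Module.Finite L (AddMonoidAlgebra (DualNumber L) G) :=
  Module.Finite.equiv
    { (AddMonoidAlgebra.coeffAddEquiv (R := DualNumber L) (M := G)).symm with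
      map_smul' := fun _ _ => rfl : (G →₀ DualNumber L) ≃ₗ[L] AddMonoidAlgebra (DualNumber L) G }

/-- The `L`-bilinear form on `(L + uL)[G]` given by the `u`-component of the Euclidean inner
product. -/
noncomputable def sndForm : LinearMap.BilinForm L (AddMonoidAlgebra (DualNumber L) G) :=
  LinearMap.mk₂ L (fun u v => (euclideanInner u v).snd)
    (fun x y z => by simp [euclideanInner, add_mul, Finset.sum_add_distrib])
    (fun c x y => by simp [euclideanInner, ← Finset.smul_sum])
    (fun x y z => by simp [euclideanInner, mul_add, Finset.sum_add_distrib])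
    (fun c x y => by simp [euclideanInner, ← Finset.smul_sum])

omit [AddCommGroup G] in
lemma sndForm_apply (u v : AddMonoidAlgebra (DualNumber L) G) :
    sndForm u v = (euclideanInner u v).snd := rfl

omit [AddCommGroup G] in
lemma sndForm_isRefl : (sndForm (L := L) (G := G)).IsRefl := fun u v h => by
  rwa [sndForm_apply, euclideanInner_comm]

/-- Pairing with `u Y^g` reads off the constant part of the coefficient at `g`, and pairing with
`Y^g` its `u`-part. -/
lemma sndForm_nondegenerate : (sndForm (L := L) (G := G)).Nondegenerate := by
  classical
  have key : ∀ u : AddMonoidAlgebra (DualNumber L) G, (∀ v, sndForm u v = 0) → u = 0 := by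
    intro u hu
    ext g
    · simpa [sndForm_apply, euclideanInner_single] using
        hu (AddMonoidAlgebra.single g DualNumber.eps)
    · simpa [sndForm_apply, euclideanInner_single] using hu (AddMonoidAlgebra.single g 1)
  exact ⟨key, fun v hv => key v fun u => sndForm_isRefl _ _ (hv u)⟩

/-- An ideal is stable under multiplication by `u`, which moves the constant part of an inner
product to its `u`-part; so the `u`-part alone detects orthogonality. -/
lemma mem_euclideanDual_iff_sndForm (C : Ideal (AddMonoidAlgebra (DualNumber L) G))
    (u : AddMonoidAlgebra (DualNumber L) G) :
    u ∈ euclideanDual C ↔ ∀ v ∈ C, sndForm u v = 0 := by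
  refine ⟨fun h v hv => by rw [sndForm_apply, h v hv, TrivSqZeroExt.snd_zero], fun h v hv => ?_⟩
  ext
  · have := h _ (C.mul_mem_left (AddMonoidAlgebra.single 0 DualNumber.eps) hv)
    rw [sndForm_apply, euclideanInner_single_zero_mul] at this
    simpa using this
  · exact h v hv

/-- Duals of ideals are orthogonal complements for a nondegenerate form over the field `L`, where
taking the complement twice gives back the subspace. -/
theorem eq_euclideanDual_symm {C D : Ideal (AddMonoidAlgebra (DualNumber L) G)}
    (h : (D : Set (AddMonoidAlgebra (DualNumber L) G)) = euclideanDual C) :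
    (C : Set (AddMonoidAlgebra (DualNumber L) G)) = euclideanDual D := by
  have hC : (sndForm (L := L) (G := G)).orthogonal (C.restrictScalars L) =
      D.restrictScalars L := by
    ext u
    rw [LinearMap.BilinForm.mem_orthogonal_iff, Submodule.restrictScalars_mem, ← SetLike.mem_coe,
      h, mem_euclideanDual_iff_sndForm]
    exact forall₂_congr fun v _ => ⟨fun e => sndForm_isRefl _ _ e, fun e => sndForm_isRefl _ _ e⟩
  have hD := LinearMap.BilinForm.orthogonal_orthogonal sndForm_nondegenerate sndForm_isRefl
    (C.restrictScalars L)
  rw [hC] at hD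
  ext u
  rw [SetLike.mem_coe, ← Submodule.restrictScalars_mem L, ← hD,
    LinearMap.BilinForm.mem_orthogonal_iff, mem_euclideanDual_iff_sndForm]
  exact forall₂_congr fun v _ => ⟨fun e => sndForm_isRefl _ _ e, fun e => sndForm_isRefl _ _ e⟩

end DoubleDual

/-! ### Ideals and annihilators in a finite product of rings -/

section Product

variable {R ι : Type*} [CommRing R] {S : ι → Type*} [∀ i, CommRing (S i)]
  {φ : ∀ i, R →+* S i}

lemma surjective_of_bijective_pi (hφ : Function.Bijective (RingHom.pi φ)) (i : ι) :
    Function.Surjective (φ i) := fun w => by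
  classical
  obtain ⟨r, hr⟩ := hφ.2 (Pi.single i w)
  exact ⟨r, by simpa using congr_fun hr i⟩

lemma mem_of_forall_mem_map [Finite ι] (hφ : Function.Bijective (RingHom.pi φ)) (C : Ideal R)
    (v : R) (h : ∀ i, φ i v ∈ C.map (φ i)) : v ∈ C := by
  classical
  cases nonempty_fintype ι
  -- The `e i` are the idempotents of the decomposition; they glue the local witnesses `c i` into
  -- `v`.
  choose e he using fun i => hφ.2 (Pi.single i 1)
  choose c hc hcv using fun i => (Ideal.mem_map_iff_of_surjective (φ i)
    (surjective_of_bijective_pi hφ i)).1 (h i)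
  have : v = ∑ i, e i * c i := by
    apply hφ.1
    funext j
    have hj : ∀ i, φ j (e i) = (Pi.single i 1 : ∀ i, S i) j := fun i => congr_fun (he i) j
    simp only [RingHom.pi_apply, map_sum, map_mul, hj]
    rw [Finset.sum_eq_single j (fun i _ hi => by simp [Pi.single_eq_of_ne hi.symm]) (by simp)]
    simp [hcv]
  rw [this]
  exact C.sum_mem fun i _ => C.mul_mem_left _ (hc i)

lemma mem_iff_forall_mem_map [Finite ι] (hφ : Function.Bijective (RingHom.pi φ)) (C : Ideal R)
    (v : R) :
    v ∈ C ↔ ∀ i, φ i v ∈ C.map (φ i) :=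
  ⟨fun h _ => Ideal.mem_map_of_mem _ h, mem_of_forall_mem_map hφ C v⟩

lemma eq_iff_forall_map_eq [Finite ι] (hφ : Function.Bijective (RingHom.pi φ)) (C D : Ideal R) :
    C = D ↔ ∀ i, C.map (φ i) = D.map (φ i) := by
  refine ⟨fun h i => by rw [h], fun h => ?_⟩
  ext v
  simp only [mem_iff_forall_mem_map hφ _ v, h]

/-- The component of the annihilator of a set is the annihilator of the component of the set. -/
lemma mem_map_iff_forall_mul_eq_zero (hφ : Function.Bijective (RingHom.pi φ)) {D : Ideal R}
    {X : Set R} (hD : ∀ u, u ∈ D ↔ ∀ v ∈ X, u * v = 0) (i : ι) (w : S i) :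
    w ∈ D.map (φ i) ↔ ∀ v ∈ X, w * φ i v = 0 := by
  classical
  obtain ⟨r, hr⟩ := hφ.2 (Pi.single i w)
  have hrj : ∀ j, φ j r = (Pi.single i w : ∀ i, S i) j := fun j => congr_fun hr j
  constructor
  · intro h v hv
    obtain ⟨u, hu, rfl⟩ := (Ideal.mem_map_iff_of_surjective (φ i)
      (surjective_of_bijective_pi hφ i)).1 h
    rw [← map_mul, (hD u).1 hu v hv, map_zero]
  · intro h
    have hr' : r ∈ D := by
      refine (hD r).2 fun v hv => hφ.1 ?_
      funext j
      simp only [RingHom.pi_apply, map_mul, hrj, map_zero]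
      by_cases hj : j = i
      · subst hj
        simpa using h v hv
      · simp [Pi.single_eq_of_ne hj]
    simpa [hrj] using Ideal.mem_map_of_mem (φ i) hr'

end Product

/-! ### Cyclotomic classes as orbits of multiplication by `2^k` -/

section CyclotomicClasses

variable {A : Type*} [AddCommGroup A] (k : ℕ)

lemma iterate_two_pow_smul (i : ℕ) (a : A) :
    (fun x : A => 2 ^ k • x)^[i] a = 2 ^ (k * i) • a := by
  rw [smul_iterate_apply, ← pow_mul]

lemma mem_cycClass_self (a : A) : a ∈ cycClass k a := ⟨0, by simp⟩

variable (hA : Odd (Nat.card A))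
include hA

lemma two_pow_smul_injective (n : ℕ) : Function.Injective fun x : A => 2 ^ n • x :=
  (Nat.Coprime.nsmul_right_bijective (hA.coprime_two_right.pow_right n)).injective

variable [Finite A]

lemma minimalPeriod_two_pow_smul_pos (a : A) :
    0 < Function.minimalPeriod (fun x : A => 2 ^ k • x) a :=
  Function.minimalPeriod_pos_of_mem_periodicPts
    ((two_pow_smul_injective hA k).mem_periodicPts a)

lemma ncard_cycClass (a : A) :
    (cycClass k a).ncard = Function.minimalPeriod (fun x : A => 2 ^ k • x) a := by
  set f := fun x : A => 2 ^ k • x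
  have h : cycClass k a = (fun i => f^[i] a) '' Set.Iio (Function.minimalPeriod f a) := by
    ext x
    constructor
    · rintro ⟨i, rfl⟩
      refine ⟨i % Function.minimalPeriod f a,
        Nat.mod_lt _ (minimalPeriod_two_pow_smul_pos k hA a), ?_⟩
      simp only [Function.iterate_mod_minimalPeriod_eq]
      exact iterate_two_pow_smul k i a
    · rintro ⟨i, -, rfl⟩
      exact ⟨i, iterate_two_pow_smul k i a⟩
  rw [h, Function.iterate_injOn_Iio_minimalPeriod.ncard_image]
  simp [Set.ncard_eq_toFinset_card']

lemma ncard_cycClass_pos (a : A) : 0 < (cycClass k a).ncard := by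
  rw [ncard_cycClass k hA]
  exact minimalPeriod_two_pow_smul_pos k hA a

/-- Characterizes the size of a class by divisibility; sizes and field degrees are compared through
it. -/
lemma two_pow_smul_eq_self_iff (a : A) (i : ℕ) :
    2 ^ (k * i) • a = a ↔ (cycClass k a).ncard ∣ i := by
  rw [ncard_cycClass k hA, ← Function.isPeriodicPt_iff_minimalPeriod_dvd, Function.IsPeriodicPt,
    Function.IsFixedPt, iterate_two_pow_smul]

lemma cycClass_eq_of_mem {a x : A} (hx : x ∈ cycClass k a) : cycClass k a = cycClass k x := by
  obtain ⟨i, rfl⟩ := hx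
  have hm := (two_pow_smul_eq_self_iff k hA a _).2 (Dvd.intro_left i rfl)
  have hi : i ≤ i * (cycClass k a).ncard := Nat.le_mul_of_pos_right _ (ncard_cycClass_pos k hA a)
  ext y
  constructor
  · rintro ⟨j, rfl⟩
    -- The exponent `i * |S(a)|` is a multiple of the period, so completing `i` to it undoes the
    -- shift by `i`.
    refine ⟨j + (i * (cycClass k a).ncard - i), ?_⟩
    rw [smul_smul, ← pow_add, ← mul_add]
    conv_lhs => rw [← hm, smul_smul, ← pow_add, ← mul_add]
    congr 3
    omega
  · rintro ⟨j, rfl⟩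
    exact ⟨j + i, by rw [smul_smul, ← pow_add, ← mul_add]⟩

lemma mem_cycClass_iff {a x : A} : x ∈ cycClass k a ↔ cycClass k a = cycClass k x :=
  ⟨cycClass_eq_of_mem k hA, fun h => h ▸ mem_cycClass_self k x⟩

/-- The map `x ↦ -2^n x` is injective and commutes with multiplication by `2^k`, so it preserves
periods. -/
lemma ncard_cycClass_neg_smul (n : ℕ) (a : A) :
    (cycClass k (-(2 ^ n • a))).ncard = (cycClass k a).ncard := by
  have h : ∀ i, (cycClass k (-(2 ^ n • a))).ncard ∣ i ↔ (cycClass k a).ncard ∣ i := fun i => by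
    rw [← two_pow_smul_eq_self_iff k hA, ← two_pow_smul_eq_self_iff k hA, smul_neg, neg_inj,
      smul_comm]
    exact (two_pow_smul_injective hA n).eq_iff
  exact Nat.dvd_antisymm ((h _).2 dvd_rfl) ((h _).1 dvd_rfl)

lemma card_eq_sum_ncard_cycClass {ι : Type*} [Fintype ι] {r : ι → A}
    (hr : ∀ x, ∃! i, cycClass k (r i) = cycClass k x) :
    Nat.card A = ∑ i, (cycClass k (r i)).ncard := by
  classical
  cases nonempty_fintype A
  choose f hf hf' using hr
  rw [Nat.card_eq_fintype_card, ← Finset.card_univ,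
    Finset.card_eq_sum_card_fiberwise (f := f) (t := Finset.univ) (by simp)]
  refine Finset.sum_congr rfl fun i _ => ?_
  rw [← Set.ncard_coe_finset]
  congr 1
  ext x
  simp only [Finset.coe_filter, Finset.mem_univ, true_and, Set.mem_ofPred_eq]
  rw [mem_cycClass_iff k hA]
  exact ⟨fun h => h ▸ hf x, fun h => (hf' x i h).symm⟩

/-- A class of type `I'` has an odd number `m` of elements, and `2^{km/2}` acts on it as `-1`. -/
lemma IsTypeI'.odd_and_smul_eq_neg (hk : Even k) {a : A} (h : IsTypeI' k a) :
    Odd (cycClass k a).ncard ∧ 2 ^ (k / 2 * (cycClass k a).ncard) • a = -a := by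
  obtain ⟨q, hq⟩ := hk
  have hq2 : k / 2 = q := by omega
  rw [hq2]
  set m := (cycClass k a).ncard with hm
  have hper : ∀ t, 2 ^ (k * (m * t)) • a = a := fun t =>
    (two_pow_smul_eq_self_iff k hA a _).2 (Dvd.intro t rfl)
  have hmem : -(2 ^ (k / 2) • a) ∈ cycClass k a := by
    rw [h]
    exact mem_cycClass_self k _
  obtain ⟨i, hi⟩ := hmem
  have hmpos : 0 < m := ncard_cycClass_pos k hA a
  -- Adding the period `m` to `i` makes it positive, so that `2^{k/2}` can be cancelled from
  -- `-2^{k/2} a = 2^{ki} a`.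
  obtain ⟨j, hj⟩ : ∃ j, i + m = j + 1 := ⟨i + m - 1, by omega⟩
  have hneg : 2 ^ (q * (2 * j + 1)) • a = -a := by
    apply two_pow_smul_injective hA q
    have e : q + q * (2 * j + 1) = k * i + k * (m * 1) := by
      rw [hq, mul_one, ← mul_add, hj]
      ring
    simp only [smul_neg]
    rw [smul_smul, ← pow_add, e, pow_add, mul_smul, hper, ← hi, hq2]
  -- Applying `hneg` twice shows that `2^{k(2j+1)}` fixes `a`. A divisor of an odd number is odd,
  -- and the cofactor is odd too, so the exponent in `hneg` reduces to `q * m` modulo the period `k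
  -- * m`.
  have hdvd : m ∣ 2 * j + 1 := by
    rw [hm, ← two_pow_smul_eq_self_iff k hA, hq, add_mul, pow_add, mul_smul, hneg, smul_neg, hneg,
      neg_neg]
  obtain ⟨t, ht⟩ := hdvd
  have hodd : Odd (m * t) := ht ▸ odd_two_mul_add_one j
  obtain ⟨hmo, u, rfl⟩ := Nat.odd_mul.1 hodd
  refine ⟨hmo, ?_⟩
  have e : q * (2 * j + 1) = q * m + k * (m * u) := by
    rw [ht, hq]
    ring
  rw [← hneg, e, pow_add, mul_smul, hper]

end CyclotomicClasses

/-! ### The size of the component fields -/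

section ComponentField

variable {F Ω A : Type*} [Field F] [Field Ω] [Algebra F Ω] [AddCommGroup A]

lemma pow_two_pow_eq_smul_apply (ψ : A ≃+ AddChar A Ω) (a x : A) (n : ℕ) :
    ψ a x ^ 2 ^ n = ψ (2 ^ n • a) x := by
  rw [map_nsmul, AddChar.nsmul_apply]

variable [Finite A]

instance finiteDimensional_compField (ψ : A ≃+ AddChar A Ω) (a : A) :
    FiniteDimensional F (compField F ψ a) := by
  refine IntermediateField.finiteDimensional_adjoin ?_
  rintro _ ⟨x, rfl⟩
  refine IsIntegral.of_pow (Nat.card_pos (α := A)) ?_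
  rw [← AddChar.map_nsmul_eq_pow, card_nsmul_eq_zero', AddChar.map_zero_eq_one]
  exact isIntegral_one

instance finite_compField [Finite F] (ψ : A ≃+ AddChar A Ω) (a : A) : Finite (compField F ψ a) :=
  Module.finite_of_finite F

/-- The degree is the order of the Frobenius over `F`. Its `i`-th power is trivial iff it fixes the
generators `ψ a x`, that is, iff `2^{ki} a = a`. -/
theorem finrank_compField (hA : Odd (Nat.card A)) {k : ℕ} (hF : Nat.card F = 2 ^ k)
    (ψ : A ≃+ AddChar A Ω) (a : A) :
    Module.finrank F (compField F ψ a) = (cycClass k a).ncard := by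
  have : Finite F := Nat.finite_of_card_ne_zero (by rw [hF]; positivity)
  cases nonempty_fintype F
  have hF' : Fintype.card F = 2 ^ k := by rw [← Nat.card_eq_fintype_card, hF]
  have key : ∀ i, Module.finrank F (compField F ψ a) ∣ i ↔ (cycClass k a).ncard ∣ i := fun i => by
    have hpow : ∀ t : compField F ψ a,
        (FiniteField.frobeniusAlgHom F (compField F ψ a) ^ i) t = t ^ 2 ^ (k * i) := fun t => by
      rw [AlgHom.coe_pow, FiniteField.coe_frobeniusAlgHom, pow_iterate, hF', pow_mul]
    rw [← FiniteField.orderOf_frobeniusAlgHom, orderOf_dvd_iff_pow_eq_one,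
      ← two_pow_smul_eq_self_iff k hA]
    constructor
    · intro h
      apply ψ.injective
      ext x
      have := congr_arg Subtype.val ((hpow ⟨ψ a x, mem_compField ψ a x⟩).symm.trans
        (DFunLike.congr_fun h _))
      rw [← pow_two_pow_eq_smul_apply]
      simpa using this
    · intro h
      refine IntermediateField.algHom_ext_of_eq_adjoin F rfl ?_
      rintro _ ⟨x, rfl⟩
      rw [hpow]
      ext
      simp [pow_two_pow_eq_smul_apply, h]
  exact Nat.dvd_antisymm ((key _).2 dvd_rfl) ((key _).1 dvd_rfl)

theorem card_compField (hA : Odd (Nat.card A)) {k : ℕ} (hF : Nat.card F = 2 ^ k)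
    (ψ : A ≃+ AddChar A Ω) (a : A) :
    Nat.card (compField F ψ a) = 2 ^ classExp k a := by
  rw [Module.natCard_eq_pow_finrank (K := F), finrank_compField hA hF, hF, classExp, pow_mul]

end ComponentField

/-! ### The Fourier transform on coefficients and under conjugation -/

section Transform

variable {F L A : Type*} [Field F] [Field L] [CharP L 2] [AddCommGroup A]

lemma mapRingHom_dft {M : Type*} [Field M] [CharP M 2] (s : ℕ) (σ : F →+* L) (τ : L →+* M)
    (χ : AddChar A L) (χ' : AddChar A M) (h : ∀ x, χ' x = τ (χ x))
    (v : AddMonoidAlgebra F (A × ZMod 2 × ZMod (2 ^ s))) :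
    AddMonoidAlgebra.mapRingHom (ZMod (2 ^ s)) (dualMap τ) (dft s σ χ v) =
      dft s (τ.comp σ) χ' v := by
  induction v using AddMonoidAlgebra.induction_linear with
  | zero => simp
  | add x y hx hy => simp [hx, hy]
  | single g c =>
    obtain ⟨x, y, z⟩ := g
    have h1 : dualMap τ (1 + DualNumber.eps) = 1 + DualNumber.eps := by
      ext <;> simp [dualMap]
    have h2 : ∀ t, dualMap τ (TrivSqZeroExt.inl t) = TrivSqZeroExt.inl (τ t) := fun t => by
      ext <;> simp [dualMap]
    simp [dft_single, h, h1, h2]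

/-- Inverting group elements inverts `χ` and `Y`, but leaves `(1 + u)^y` alone because `-y = y` in
`ℤ₂`. -/
lemma dft_conjHom (s : ℕ) (σ : F →+* L) (ρ : F →+* F) (χ : AddChar A L)
    (v : AddMonoidAlgebra F (A × ZMod 2 × ZMod (2 ^ s))) :
    dft s σ χ (conjHom ρ v) = conjHom (RingHom.id _) (dft s (σ.comp ρ) (-χ) v) := by
  induction v using AddMonoidAlgebra.induction_linear with
  | zero => simp
  | add x y hx hy => simp [hx, hy]
  | single g c =>
    obtain ⟨x, y, z⟩ := g
    simp [dft_single, ZMod.neg_eq_self_mod_two]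

variable [Fintype A]

lemma coeff_dft (s : ℕ) (σ : F →+* L) (χ : AddChar A L)
    (v : AddMonoidAlgebra F (A × ZMod 2 × ZMod (2 ^ s))) (z : ZMod (2 ^ s)) :
    (dft s σ χ v).coeff z = ∑ x, ∑ y : ZMod 2,
      TrivSqZeroExt.inl (σ (v.coeff (x, y, z)) * χ x) * (1 + DualNumber.eps) ^ y.val := by
  classical
  induction v using AddMonoidAlgebra.induction_linear with
  | zero => simp
  | add x y hx hy => simp [hx, hy, add_mul, Finset.sum_add_distrib]
  | single g c =>
    obtain ⟨x, y, z'⟩ := g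
    rw [dft_single, AddMonoidAlgebra.coeff_single, Finset.sum_eq_single x, Finset.sum_eq_single y]
    · by_cases hz : z' = z
      · simp [hz]
      · simp [hz]
    · intro y' _ hy
      simp [hy.symm]
    · simp
    · intro x' _ hx
      simp [hx.symm]
    · simp

lemma sum_eq_zero_of_dft_eq_zero {s : ℕ} {σ : F →+* L} {χ : AddChar A L}
    {v : AddMonoidAlgebra F (A × ZMod 2 × ZMod (2 ^ s))} (h : dft s σ χ v = 0)
    (y : ZMod 2) (z : ZMod (2 ^ s)) : ∑ x, σ (v.coeff (x, y, z)) * χ x = 0 := by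
  have huniv : (Finset.univ : Finset (ZMod 2)) = {0, 1} := rfl
  have hz : (dft s σ χ v).coeff z = 0 := by simp [h]
  rw [coeff_dft] at hz
  -- Only `y = 1` contributes to the `u`-part, whereas both values of `y` contribute to the constant
  -- part; hence this order.
  have h1 : ∑ x, σ (v.coeff (x, 1, z)) * χ x = 0 := by
    have := congr_arg TrivSqZeroExt.snd hz
    simpa [huniv, ZMod.val_one, TrivSqZeroExt.snd_sum] using this
  have h0 : ∑ x, σ (v.coeff (x, 0, z)) * χ x = 0 := by
    have := congr_arg TrivSqZeroExt.fst hz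
    simpa [huniv, ZMod.val_one, TrivSqZeroExt.fst_sum, Finset.sum_add_distrib, h1] using this
  fin_cases y
  exacts [h0, h1]

end Transform

/-! ### How conjugation acts on the components -/

section Components

lemma pow_two_pow_card {F : Type*} [Field F] {k : ℕ} (hF : Nat.card F = 2 ^ k) (c : F) (i : ℕ) :
    c ^ 2 ^ (k * i) = c := by
  have : Finite F := Nat.finite_of_card_ne_zero (by rw [hF]; positivity)
  cases nonempty_fintype F
  rw [pow_mul, ← hF, Nat.card_eq_fintype_card, FiniteField.pow_card_pow]

variable {F Ω A : Type*} [Field F] [CharP F 2] [Field Ω] [Algebra F Ω] [AddCommGroup A] [Finite A]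
  {k : ℕ}

variable (hA : Odd (Nat.card A)) (hk : Even k) (hF : Nat.card F = 2 ^ k) (ψ : A ≃+ AddChar A Ω)

include hA hk hF in
-- Removes the inverse Frobenius from the definition: this is the transform at the inverse character
-- `-ψ a`, with scalars conjugated.
lemma partnerComp_apply (s : ℕ) (a : A)
    (v : AddMonoidAlgebra F (A × ZMod 2 × ZMod (2 ^ s))) :
    partnerComp k s ψ a v =
      dft s ((algebraMap F (compField F ψ a)).comp (iterateFrobenius F 2 (k / 2)))
        (-restrictChar _ (ψ a) (mem_compField ψ a)) v := by
  have hm := ncard_cycClass_pos k hA a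
  -- On `F` only the exponent modulo `k` matters, so the inverse of `c ↦ c^{2^{k/2}}` acts there as
  -- that map itself.
  have he : classExp k a - k / 2 = k / 2 + k * ((cycClass k a).ncard - 1) := by
    obtain ⟨q, rfl⟩ := hk
    obtain ⟨m, hm⟩ : ∃ m, (cycClass (q + q) a).ncard = m + 1 := ⟨_, (Nat.sub_add_cancel hm).symm⟩
    rw [classExp, hm, Nat.add_sub_cancel, mul_add]
    omega
  have he' : k / 2 + (classExp k a - k / 2) = k * (cycClass k a).ncard := by
    have : k / 2 ≤ classExp k a := (Nat.div_le_self _ _).trans (Nat.le_mul_of_pos_right _ hm)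
    rw [Nat.add_sub_cancel' this, classExp]
  rw [partnerComp, RingHom.comp_apply, mapRingHom_dft s _ _ _
    (-restrictChar _ (ψ a) (mem_compField ψ a))]
  · congr 2
    ext c
    simp only [RingHom.comp_apply, iterateFrobenius_def]
    rw [← map_pow, he, pow_add, pow_mul, pow_two_pow_card hF]
  · intro x
    ext
    simp only [AddChar.neg_apply, restrictChar, AddChar.coe_mk, iterateFrobenius_def,
      SubmonoidClass.coe_pow]
    rw [pow_two_pow_eq_smul_apply, smul_neg, smul_smul, ← pow_add, add_comm, he',
      (two_pow_smul_eq_self_iff k hA a _).2 dvd_rfl, map_neg ψ, AddChar.neg_apply]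

include hA hk hF in
lemma comp_conjHom (s : ℕ) (a : A) (v : AddMonoidAlgebra F (A × ZMod 2 × ZMod (2 ^ s))) :
    comp s ψ a (conjHom (iterateFrobenius F 2 (k / 2)) v) =
      conjHom (RingHom.id _) (partnerComp k s ψ a v) := by
  rw [comp, dft_conjHom, partnerComp_apply hA hk hF]

include hA hk hF in
lemma partnerComp_conjHom (s : ℕ) (a : A)
    (v : AddMonoidAlgebra F (A × ZMod 2 × ZMod (2 ^ s))) :
    partnerComp k s ψ a (conjHom (iterateFrobenius F 2 (k / 2)) v) =
      conjHom (RingHom.id _) (comp s ψ a v) := by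
  have h : (iterateFrobenius F 2 (k / 2)).comp (iterateFrobenius F 2 (k / 2)) = RingHom.id F := by
    obtain ⟨q, rfl⟩ := hk
    ext c
    have := pow_two_pow_card hF c 1
    simp only [RingHom.comp_apply, iterateFrobenius_def, RingHom.id_apply]
    rw [← pow_mul, ← pow_add]
    convert this using 3
    omega
  rw [partnerComp_apply hA hk hF, dft_conjHom, neg_neg, RingHom.comp_assoc, h, RingHom.comp_id,
    comp]

include hA hk hF in
-- With `m` the size of the class, the involution `t ↦ t^{2^{km/2}}` of `K_a` inverts the values of
-- `ψ a`, since `2^{km/2} a = -a`; it restricts to the conjugation of `F` because `m` is odd.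
lemma comp_conjHom_of_isTypeI' (s : ℕ) {a : A} (ha : IsTypeI' k a)
    (v : AddMonoidAlgebra F (A × ZMod 2 × ZMod (2 ^ s))) :
    comp s ψ a (conjHom (iterateFrobenius F 2 (k / 2)) v) =
      conjHom (dualMap (iterateFrobenius (compField F ψ a) 2 (classExp k a / 2)))
        (comp s ψ a v) := by
  obtain ⟨⟨n, hn⟩, hneg⟩ := ha.odd_and_smul_eq_neg k hA hk
  have he : classExp k a / 2 = k / 2 * (cycClass k a).ncard := by
    rw [classExp, Nat.div_mul_right_comm hk.two_dvd]
  have he' : k / 2 * (cycClass k a).ncard = k / 2 + k * n := by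
    obtain ⟨q, rfl⟩ := hk
    rw [hn, show (q + q) / 2 = q by omega]
    ring
  rw [conjHom_eq_conjHom_id (dualMap (iterateFrobenius (compField F ψ a) 2 _)), comp, dft_conjHom,
    mapRingHom_dft s _ _ _
    (-restrictChar _ (ψ a) (mem_compField ψ a))]
  · congr 3
    ext c
    simp only [RingHom.comp_apply, iterateFrobenius_def]
    rw [← map_pow, he, he', pow_add, pow_mul, pow_two_pow_card hF]
  · intro x
    ext
    simp only [AddChar.neg_apply, restrictChar, AddChar.coe_mk, iterateFrobenius_def,
      SubmonoidClass.coe_pow]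
    rw [pow_two_pow_eq_smul_apply, he, hneg, map_neg ψ, AddChar.neg_apply]

end Components

/-! ### Bijectivity of the decomposition -/

section Bijective

variable {F Ω A : Type*} [Field F] [Field Ω] [Algebra F Ω] [AddCommGroup A]

/-- The discrete Fourier transform over the full character group is injective. -/
lemma eq_zero_of_forall_sum_mul_eq_zero [Fintype A] (ψ : A ≃+ AddChar A Ω) {c : A → Ω}
    (h : ∀ a, ∑ x, c x * ψ a x = 0) : c = 0 := by
  classical
  let M : Matrix A A Ω := Matrix.of fun a x => ψ a x
  have hM : IsUnit M := by
    rw [← Matrix.linearIndependent_rows_iff_isUnit]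
    exact (linearIndependent_monoidHom (Multiplicative A) Ω).comp (fun a => (ψ a).toMonoidHom)
      fun a a' h => ψ.injective (AddChar.toMonoidHomEquiv.injective h)
  apply Matrix.mulVec_injective_of_isUnit hM
  funext a
  simpa [M, Matrix.mulVec, dotProduct, mul_comm] using h a

lemma card_dualNumber (L : Type*) [Field L] : Nat.card (DualNumber L) = Nat.card L ^ 2 :=
  (Nat.card_prod L L).trans (sq _).symm

lemma card_groupRing (R G : Type*) [Semiring R] [Finite G] :
    Nat.card (AddMonoidAlgebra R G) = Nat.card R ^ Nat.card G := by
  rw [Nat.card_congr (AddMonoidAlgebra.coeffEquiv.trans Finsupp.equivFunOnFinite), Nat.card_fun]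

instance finite_groupRing (R G : Type*) [Semiring R] [Finite R] [Finite G] :
    Finite (AddMonoidAlgebra R G) :=
  Finite.of_equiv _ (AddMonoidAlgebra.coeffEquiv.trans Finsupp.equivFunOnFinite).symm

instance finite_dualNumber_of_finite (L : Type*) [Field L] [Finite L] : Finite (DualNumber L) :=
  inferInstanceAs (Finite (L × L))

lemma dualMap_injective {L M : Type*} [Field L] [Field M] (f : L →+* M) :
    Function.Injective (dualMap f) := fun x y h => by
  have h1 := congr_arg TrivSqZeroExt.fst h
  have h2 := congr_arg TrivSqZeroExt.snd h
  simp only [dualMap, RingHom.coe_mk, MonoidHom.coe_mk, OneHom.coe_mk, TrivSqZeroExt.fst_add,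
    TrivSqZeroExt.fst_inl, TrivSqZeroExt.fst_inr, add_zero, TrivSqZeroExt.snd_add,
    TrivSqZeroExt.snd_inl, TrivSqZeroExt.snd_inr, zero_add] at h1 h2
  exact TrivSqZeroExt.ext (f.injective h1) (f.injective h2)

variable [CharP F 2] {k : ℕ} {r₁ r₂ : ℕ} {a : Fin r₁ → A} {b : Fin r₂ → A}

lemma dft_eq_zero_of_partnerComp_eq_zero {s : ℕ} {ψ : A ≃+ AddChar A Ω} {a : A}
    {v : AddMonoidAlgebra F (A × ZMod 2 × ZMod (2 ^ s))} (h : partnerComp k s ψ a v = 0) :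
    dft s (algebraMap F (compField F ψ a))
      (restrictChar _ (ψ (-(2 ^ (k / 2) • a))) (neg_nsmul_mem_compField ψ a _)) v = 0 := by
  refine AddMonoidAlgebra.map_injective
    (dualMap (iterateFrobenius (compField F ψ a) 2 (classExp k a - k / 2))).toAddMonoidHom
    (dualMap_injective _) ?_
  rw [AddMonoidAlgebra.map_zero]
  exact h

lemma decomposition_injective [Finite A] (hA : Odd (Nat.card A)) (hF : Nat.card F = 2 ^ k)
    (s : ℕ) (ψ : A ≃+ AddChar A Ω) (hab : IsRepresentatives k a b) :
    Function.Injective (decomposition (F := F) k s ψ a b) := by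
  cases nonempty_fintype A
  have : CharP Ω 2 := charP_of_injective_algebraMap (algebraMap F Ω).injective 2
  rw [injective_iff_map_eq_zero]
  intro v hv
  have h1 : ∀ j, comp s ψ (a j) v = 0 := fun j => congr_fun (congr_arg Prod.fst hv) j
  have h2 : ∀ l, comp s ψ (b l) v = 0 := fun l =>
    congr_arg Prod.fst (congr_fun (congr_arg Prod.snd hv) l)
  have h3 : ∀ l, partnerComp k s ψ (b l) v = 0 := fun l =>
    congr_arg Prod.snd (congr_fun (congr_arg Prod.snd hv) l)
  have hrep : ∀ i y z, ∑ x, algebraMap F Ω (v.coeff (x, y, z)) *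
      ψ (Sum.elim a (Sum.elim b fun l => -(2 ^ (k / 2) • b l)) i) x = 0 := by
    rintro (j | l | l) y z
    · simpa [restrictChar] using
        congr_arg (algebraMap _ Ω) (sum_eq_zero_of_dft_eq_zero (h1 j) y z)
    · simpa [restrictChar] using
        congr_arg (algebraMap _ Ω) (sum_eq_zero_of_dft_eq_zero (h2 l) y z)
    · simpa [restrictChar] using congr_arg (algebraMap _ Ω)
        (sum_eq_zero_of_dft_eq_zero (dft_eq_zero_of_partnerComp_eq_zero (h3 l)) y z)
  have hall : ∀ t y z, ∑ x, algebraMap F Ω (v.coeff (x, y, z)) * ψ t x = 0 := by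
    intro t y z
    obtain ⟨i, hi, -⟩ := hab.complete t
    obtain ⟨n, hn⟩ := (mem_cycClass_iff k hA).2 hi
    -- This power is additive in characteristic 2, fixes the coefficients from `F`, and turns the
    -- character at the representative into the one at `t`.
    have := congr_arg (· ^ 2 ^ (k * n)) (hrep i y z)
    simp only [sum_pow_char_pow, mul_pow, pow_two_pow_eq_smul_apply, ← hn, ← map_pow,
      pow_two_pow_card hF] at this
    rwa [zero_pow (by positivity)] at this
  ext ⟨x, y, z⟩
  have := congr_fun (eq_zero_of_forall_sum_mul_eq_zero ψ fun t => hall t y z) x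
  simpa using this

lemma decomposition_bijective [Finite A] (hA : Odd (Nat.card A)) (hF : Nat.card F = 2 ^ k)
    (s : ℕ) (ψ : A ≃+ AddChar A Ω) (hab : IsRepresentatives k a b) :
    Function.Bijective (decomposition (F := F) k s ψ a b) := by
  have : Finite F := Nat.finite_of_card_ne_zero (by rw [hF]; positivity)
  refine (Nat.bijective_iff_injective_and_card _).2 ⟨decomposition_injective hA hF s ψ hab, ?_⟩
  have hsum := card_eq_sum_ncard_cycClass k hA hab.complete
  simp only [Fintype.sum_sum_type, Sum.elim_inl, Sum.elim_inr, ncard_cycClass_neg_smul k hA] at hsum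
  simp only [Nat.card_prod, Nat.card_pi, card_groupRing, card_dualNumber,
    card_compField hA hF, hF, Nat.card_zmod, Finset.prod_mul_distrib, Finset.prod_pow,
    Finset.prod_pow_eq_pow_sum, hsum, classExp, ← Finset.mul_sum]
  ring

end Bijective

/-! ### Componentwise description of the Hermitian dual -/

section HermitianDual

variable {F Ω A : Type*} [Field F] [CharP F 2] [Field Ω] [Algebra F Ω] [AddCommGroup A]
  {r₁ r₂ : ℕ}

/-- The rings `(L + uL)[ℤ_{2^s}]` with `L` the component of `F[A]` at `c i`. -/
noncomputable abbrev CompCodomain (F : Type*) {Ω A ι : Type*} [Field F] [Field Ω] [Algebra F Ω]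
    [AddCommGroup A] (s : ℕ) (ψ : A ≃+ AddChar A Ω) (c : ι → A) (i : ι) : Type _ :=
  AddMonoidAlgebra (CompRing F ψ (c i)) (ZMod (2 ^ s))

/-- The components of the group algebra, as a family indexed by a single type. -/
noncomputable def compFamily (k s : ℕ) (ψ : A ≃+ AddChar A Ω) (a : Fin r₁ → A) (b : Fin r₂ → A) :
    ∀ i : Fin r₁ ⊕ (Fin r₂ ⊕ Fin r₂), AddMonoidAlgebra F (A × ZMod 2 × ZMod (2 ^ s)) →+*
      CompCodomain F s ψ (Sum.elim a (Sum.elim b b)) i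
  | .inl j => comp s ψ (a j)
  | .inr (.inl l) => comp s ψ (b l)
  | .inr (.inr l) => partnerComp k s ψ (b l)

lemma compFamily_bijective {k s : ℕ} {ψ : A ≃+ AddChar A Ω} {a : Fin r₁ → A} {b : Fin r₂ → A}
    (h : Function.Bijective (decomposition (F := F) k s ψ a b)) :
    Function.Bijective (RingHom.pi (compFamily (F := F) k s ψ a b)) := by
  constructor
  · intro v w hvw
    refine h.1 (Prod.ext (funext fun j => congr_fun hvw (.inl j)) (funext fun l => Prod.ext ?_ ?_))
    exacts [congr_fun hvw (.inr (.inl l)), congr_fun hvw (.inr (.inr l))]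
  · intro w
    obtain ⟨v, hv⟩ := h.2 (fun j => w (.inl j), fun l => (w (.inr (.inl l)), w (.inr (.inr l))))
    refine ⟨v, funext ?_⟩
    rintro (j | l | l)
    exacts [congr_fun (congr_arg Prod.fst hv) j,
      congr_arg Prod.fst (congr_fun (congr_arg Prod.snd hv) l),
      congr_arg Prod.snd (congr_fun (congr_arg Prod.snd hv) l)]

/-- If a ring homomorphism `f` carries `v ↦ conjHom ρ v` to `v ↦ conjHom τ (g v)`, then the
annihilator of the conjugates of `C` is carried to the dual of the code `g(C)`. -/
lemma mem_twistedDual_map_iff {R S G H : Type*} [CommRing R] [CommRing S] [AddCommGroup G]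
    [AddCommGroup H] [Fintype H] {ρ : R →+* R} {τ : S →+* S}
    {f g : AddMonoidAlgebra R G →+* AddMonoidAlgebra S H} (hg : Function.Surjective g)
    (hfg : ∀ v, f (conjHom ρ v) = conjHom τ (g v)) (C : Ideal (AddMonoidAlgebra R G))
    (w : AddMonoidAlgebra S H) :
    w ∈ twistedDual τ (C.map g) ↔ ∀ v ∈ conjHom ρ '' C, w * f v = 0 := by
  simp only [mem_twistedDual_iff, Ideal.mem_map_iff_of_surjective g hg, Set.forall_mem_image, hfg,
    forall_exists_index, and_imp, forall_apply_eq_imp_iff₂, SetLike.mem_coe]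

theorem isHermitianSelfDual_iff [Fintype A] (hA : Odd (Nat.card A)) {k : ℕ} (hk : Even k)
    (hF : Nat.card F = 2 ^ k) (s : ℕ) (ψ : A ≃+ AddChar A Ω) {a : Fin r₁ → A} {b : Fin r₂ → A}
    (hab : IsRepresentatives k a b) (C : Ideal (AddMonoidAlgebra F (A × ZMod 2 × ZMod (2 ^ s)))) :
    IsHermitianSelfDual k C ↔
      (∀ j, IsHermitianSelfDualU (classExp k (a j)) (C.map (comp s ψ (a j)))) ∧
      (∀ l, (C.map (partnerComp k s ψ (b l)) : Set _) =
        euclideanDual (C.map (comp s ψ (b l)))) := by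
  have hφ := compFamily_bijective (decomposition_bijective hA hF s ψ hab)
  have hs := surjective_of_bijective_pi (S := CompCodomain F s ψ (Sum.elim a (Sum.elim b b)))
    (φ := compFamily k s ψ a b) hφ
  set ρ := iterateFrobenius F 2 (k / 2)
  have hD : ∀ u, u ∈ twistedDualIdeal ρ C ↔ ∀ v ∈ conjHom ρ '' C, u * v = 0 := fun u => by
    simp only [mem_twistedDualIdeal_iff, Set.forall_mem_image, SetLike.mem_coe]
  have hmap := mem_map_iff_forall_mul_eq_zero
    (S := CompCodomain F s ψ (Sum.elim a (Sum.elim b b)))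
    (φ := compFamily k s ψ a b) hφ hD
  have hI : ∀ j, ((twistedDualIdeal ρ C).map (comp s ψ (a j)) : Set _) =
      twistedDual (dualMap (iterateFrobenius (compField F ψ (a j)) 2 (classExp k (a j) / 2)))
        (C.map (comp s ψ (a j))) := fun j => Set.ext fun w => (hmap (.inl j) w).trans
    (mem_twistedDual_map_iff (hs (.inl j))
      (comp_conjHom_of_isTypeI' hA hk hF ψ s (hab.typeI j)) C w).symm
  -- The swap appears here: each component of the dual is governed by the other component of `C`.
  -- The Euclidean dual is by definition the twisted dual for the identity.
  have hII : ∀ l, ((twistedDualIdeal ρ C).map (comp s ψ (b l)) : Set _) =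
      euclideanDual (C.map (partnerComp k s ψ (b l))) := fun l => Set.ext fun w =>
    (hmap (.inr (.inl l)) w).trans (mem_twistedDual_map_iff (hs (.inr (.inr l)))
      (comp_conjHom hA hk hF ψ s (b l)) C w).symm
  have hII' : ∀ l, ((twistedDualIdeal ρ C).map (partnerComp k s ψ (b l)) : Set _) =
      euclideanDual (C.map (comp s ψ (b l))) := fun l => Set.ext fun w =>
    (hmap (.inr (.inr l)) w).trans (mem_twistedDual_map_iff (hs (.inr (.inl l)))
      (partnerComp_conjHom hA hk hF ψ s (b l)) C w).symm
  have hC : IsHermitianSelfDual k C ↔ C = twistedDualIdeal ρ C :=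
    ⟨fun h => SetLike.coe_injective h, fun h => congr_arg SetLike.coe h⟩
  rw [hC, eq_iff_forall_map_eq (S := CompCodomain F s ψ (Sum.elim a (Sum.elim b b)))
    (φ := compFamily k s ψ a b) hφ]
  constructor
  · intro h
    exact ⟨fun j => (congr_arg _ (h (.inl j))).trans (hI j),
      fun l => (congr_arg _ (h (.inr (.inr l)))).trans (hII' l)⟩
  · rintro ⟨h1, h2⟩ (j | l | l)
    · exact SetLike.coe_injective ((h1 j).trans (hI j).symm)
    -- The condition on `D_l` is not assumed; it follows from the one on `D'_l` by double duality.
    · exact SetLike.coe_injective ((eq_euclideanDual_symm (h2 l)).trans (hII l).symm)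
    · exact SetLike.coe_injective ((h2 l).trans (hII' l).symm)

end HermitianDual

end AbelianCode

theorem corollary2p4 {F Ω A : Type*} [Field F] [CharP F 2] [Field Ω] [IsAlgClosed Ω] [Algebra F Ω]
    [AddCommGroup A] [Fintype A] (hA : Odd (Fintype.card A))
    (k s : ℕ) (hk₀ : 0 < k) (hk : Even k) (hs : 0 < s) (hF : Nat.card F = 2 ^ k)
    (ψ : A ≃+ AddChar A Ω) {r₁ r₂ : ℕ} (a : Fin r₁ → A) (b : Fin r₂ → A)
    (hab : AbelianCode.IsRepresentatives k a b) :
    -- the components are fields with `2^{k_x}` elements, and the decomposition is a ring isomorphism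
    (∀ x : A, Nat.card (AbelianCode.compField F ψ x) = 2 ^ AbelianCode.classExp k x) ∧
    Function.Bijective (AbelianCode.decomposition (F := F) k s ψ a b) ∧
    ∀ C : Ideal (AddMonoidAlgebra F (A × ZMod 2 × ZMod (2 ^ s))),
      -- `C` is the product of its components `C_j`, `D_l`, `D'_l`
      (∀ v, v ∈ C ↔
        (∀ j, AbelianCode.comp s ψ (a j) v ∈ C.map (AbelianCode.comp s ψ (a j))) ∧
        (∀ l, AbelianCode.comp s ψ (b l) v ∈ C.map (AbelianCode.comp s ψ (b l)) ∧
          AbelianCode.partnerComp k s ψ (b l) v ∈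
            C.map (AbelianCode.partnerComp k s ψ (b l)))) ∧
      -- the characterization of Hermitian self-duality
      (AbelianCode.IsHermitianSelfDual k C ↔
        (∀ j, AbelianCode.IsHermitianSelfDualU (AbelianCode.classExp k (a j))
          (C.map (AbelianCode.comp s ψ (a j)))) ∧
        (∀ l, (C.map (AbelianCode.partnerComp k s ψ (b l)) : Set _) =
          AbelianCode.euclideanDual (C.map (AbelianCode.comp s ψ (b l))))) := by
  have hA' : Odd (Nat.card A) := by rwa [Nat.card_eq_fintype_card]
  have hbij := AbelianCode.decomposition_bijective hA' hF s ψ hab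
  refine ⟨AbelianCode.card_compField hA' hF ψ, hbij, fun C => ⟨fun v => ?_,
    AbelianCode.isHermitianSelfDual_iff hA' hk hF s ψ hab C⟩⟩
  rw [AbelianCode.mem_iff_forall_mem_map
    (S := AbelianCode.CompCodomain F s ψ (Sum.elim a (Sum.elim b b)))
    (φ := AbelianCode.compFamily k s ψ a b)
    (AbelianCode.compFamily_bijective hbij) C v]
  exact ⟨fun h => ⟨fun j => h (.inl j), fun l => ⟨h (.inr (.inl l)), h (.inr (.inr l))⟩⟩,
    fun h => Sum.rec h.1 (Sum.rec (fun l => (h.2 l).1) fun l => (h.2 l).2)⟩
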